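/- Let $M$ be a $C^\infty$ manifold. For an integer $h\ge 0$ let $\mathbf{T}^{big}_hM=(TM\times\mathbb{R}^h)\oplus(T^*M\times\mathbb{R}^h)$, with the neutral metric $$G\big((X_1,u_1)\oplus(\alpha_1,v_1),(X_2,u_2)\oplus(\alpha_2,v_2)\big)=\tfrac12\big(\alpha_2(X_1)+\alpha_1(X_2)+u_1\cdot v_2+u_2\cdot v_1\big).$$ Let $\Phi\in\Omega^3(M)$ and $\Psi=(\Psi^1,\dots,\Psi^h)$, $\Psi^a\in\Omega^2(M)$, be closed forms. The stable Courant bracket of index $h$ twisted by $(\Phi,\Psi)$ is the operation on smooth sections of $\mathbf{T}^{big}_hM$ given by $$[(X_1,u_1)\oplus(\alpha_1,v_1),(X_2,u_2)\oplus(\alpha_2,v_2)]=([X_1,X_2],\,X_1u_2-X_2u_1)\oplus(\beta,\;X_1v_2-X_2v_1+\Psi(X_1,X_2)),$$ $$\beta=L_{X_1}\alpha_2-L_{X_2}\alpha_1+\tfrac12 d(\alpha_1(X_2)-\alpha_2(X_1))+\Phi(X_1,X_2,\cdot)+u_1\cdot\Psi(X_2,\cdot)-u_2\cdot\Psi(X_1,\cdot)+\tfrac12(u_2\cdot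 dv_1+v_2\cdot du_1-u_1\cdot dv_2-v_1\cdot du_2).$$ It is untwisted if $\Phi=0$ and $\Psi=0$. A stable Dirac structure of index $h$ (twisted by $(\Phi,\Psi)$, respectively untwisted) is a smooth subbundle $L\subseteq\mathbf{T}^{big}_hM$ whose fibres are maximal $G$-isotropic subspaces and whose space $\Gamma L$ of smooth sections is closed under the bracket (twisted by $(\Phi,\Psi)$, respectively untwisted). A vector field $V$ on $M$ is an infinitesimal automorphism of $L$ if $([V,X],Vu)\oplus(L_V\alpha,Vv)\in\Gamma L$ for all $(X,u)\oplus(\alpha,v)\in\Gamma L$. **Theorem.** Let $L\subseteq\mathbf{T}^{big}_hM$ be an untwisted stable Dirac structure of index $h$, let $k\ge 0$, and let $V_1,\dots,V_k$ be infinitesimal automorphisms of $L$ with $[V_p,V_q]=0$ for all $p,q$. Then $$\hat L_x=\Big\{\Big(X-\sum_{p=1}^k w^pV_p(x),\;u,\;(\alpha(V_p(x)))_{p=1}^k\Big)\oplus(\alpha,v,w)\;:\;(X,u)\oplus(\alpha,v)\in L_x,\ w\in\mathbb{R}^k\Big\}\qquad(x\in M)$$ defines an untwisted stable Dirac structure $\hat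 L\subseteq\mathbf{T}^{big}_{h+k}M$ of index $h+k$. Moreover, if instead $L$ is a stable Dirac structure of index $h$ twisted by $(\Phi,\Psi)$, if $V_1,\dots,V_k$ are commuting infinitesimal automorphisms of $L$, and if $i(V_p)\Phi=0$ and $i(V_p)\Psi^a=0$ for all $p$ and $a$, then $\hat L$ is a stable Dirac structure of index $h+k$ twisted by $(\Phi,(\Psi^1,\dots,\Psi^h,0,\dots,0))$. -/

import Mathlib

open scoped Manifold ContDiff

noncomputable section

namespace StableDirac

section Manifold

variable {E : Type*} [NormedAddCommGroup E] [NormedSpace ℝ E]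
  {H : Type*} [TopologicalSpace H] (I : ModelWithCorners ℝ E H)
  {M : Type*} [TopologicalSpace M] [ChartedSpace H M]

/-! ### The stable big tangent bundle -/

/-- The cotangent space at `x`. -/
abbrev Cotangent (x : M) : Type _ := TangentSpace I x →L[ℝ] ℝ

/-- The fibre at `x` of the stable big tangent bundle of index `h`,
`(TM × ℝ^h) ⊕ (T*M × ℝ^h)`. Its elements are written `((X, u), (α, v))`. -/
abbrev Fibre (h : ℕ) (x : M) : Type _ :=
  (TangentSpace I x × (Fin h → ℝ)) × (Cotangent I x × (Fin h → ℝ))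

/-- A (rough) global section of the stable big tangent bundle of index `h`. -/
abbrev Section (M : Type*) [TopologicalSpace M] [ChartedSpace H M] (h : ℕ) : Type _ :=
  ∀ x : M, Fibre I h x

/-- A (rough) family of linear subspaces of the fibres of the stable big tangent bundle. -/
abbrev Family (M : Type*) [TopologicalSpace M] [ChartedSpace H M] (h : ℕ) : Type _ :=
  ∀ x : M, Submodule ℝ (Fibre I h x)

variable {I} in
/-- Smoothness on `U` of a section `((X, u), (α, v))`: the vector field `X` is a smooth section of
the tangent bundle, the `1`-form `α` is a smooth section of the cotangent bundle, and `u`, `v` are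
smooth functions with values in `ℝ^h`. -/
structure SmoothOn [IsManifold I ∞ M] {h : ℕ} (s : Section I M h) (U : Set M) : Prop where
  vec : ContMDiffOn I I.tangent ∞
    (fun x => (⟨x, (s x).1.1⟩ : TangentBundle I M)) U
  fst : ContMDiffOn I 𝓘(ℝ, Fin h → ℝ) ∞ (fun x => (s x).1.2) U
  form : ContMDiffOn I (I.prod 𝓘(ℝ, E →L[ℝ] ℝ)) ∞
    (fun x => Bundle.TotalSpace.mk' (E →L[ℝ] ℝ) (E := fun y : M => (TangentSpace I y →L[ℝ] ℝ))
      x (s x).2.1) U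
  snd : ContMDiffOn I 𝓘(ℝ, Fin h → ℝ) ∞ (fun x => (s x).2.2) U

/-! ### The neutral metric, isotropy, subbundles -/

variable {I} in
/-- The neutral metric
`G((X₁,u₁)⊕(α₁,v₁), (X₂,u₂)⊕(α₂,v₂)) = ½ (α₂(X₁) + α₁(X₂) + u₁·v₂ + u₂·v₁)`. -/
def metric {h : ℕ} {x : M} (ξ η : Fibre I h x) : ℝ :=
  (1 / 2 : ℝ) * (η.2.1 ξ.1.1 + ξ.2.1 η.1.1 + ξ.1.2 ⬝ᵥ η.2.2 + η.1.2 ⬝ᵥ ξ.2.2)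

variable {I} in
/-- A subspace of a fibre is isotropic if the metric vanishes on it. -/
def IsIsotropic {h : ℕ} {x : M} (N : Submodule ℝ (Fibre I h x)) : Prop :=
  ∀ ξ ∈ N, ∀ η ∈ N, metric ξ η = 0

variable {I} in
/-- A smooth subbundle: a family of subspaces which admits a smooth frame near every point. -/
def IsSubbundle [IsManifold I ∞ M] {h : ℕ} (L : Family I M h) : Prop :=
  ∀ x₀ : M, ∃ U : Set M, IsOpen U ∧ x₀ ∈ U ∧ ∃ (r : ℕ) (s : Fin r → Section I M h),
    (∀ i, SmoothOn (s i) U) ∧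
    ∀ x ∈ U, LinearIndependent ℝ (fun i => s i x) ∧
      Submodule.span ℝ (Set.range fun i => s i x) = L x

variable {I} in
/-- `s ∈ Γ L`: `s` is a smooth global section of the stable big tangent bundle with values
in `L`. -/
def IsSectionOf [IsManifold I ∞ M] {h : ℕ} (L : Family I M h) (s : Section I M h) : Prop :=
  SmoothOn s Set.univ ∧ ∀ x, s x ∈ L x

/-- A stable almost Dirac structure of index `h`: a subbundle of the stable big tangent bundle
whose fibres are maximal among the isotropic subspaces. -/
structure IsAlmostDirac [IsManifold I ∞ M] {h : ℕ} (L : Family I M h) : Prop where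
  subbundle : IsSubbundle L
  maximal_isotropic : ∀ x, Maximal IsIsotropic (L x)

/-! ### Lie derivative and contractions -/

/-- The Lie derivative `L_X α` of the `1`-form `α` along the vector field `X`, computed at `x` in
the preferred chart at `x`: if `X̂` and `α̂` are the expressions of `X` and `α` in the chart, then
`(L_X̂ α̂)(y) = (∂_{X̂} α̂)(y) + α̂(∂_y X̂)`. -/
def lieDerivForm (X : ∀ x : M, TangentSpace I x) (α : ∀ x : M, Cotangent I x) (x : M) :
    Cotangent I x :=
  let φ := extChartAt I x
  let X' : E → E := VectorField.mpullbackWithin 𝓘(ℝ, E) I φ.symm X (Set.range I)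
  let α' : E → E →L[ℝ] ℝ := fun y =>
    (α (φ.symm y)).comp (mfderivWithin 𝓘(ℝ, E) I φ.symm (Set.range I) y)
  (fderivWithin ℝ α' (Set.range I) (φ x) (X' (φ x)) +
    (α' (φ x)).comp (fderivWithin ℝ X' (Set.range I) (φ x))).comp (mfderiv I 𝓘(ℝ, E) φ x)

variable {I} in
/-- The derivative `X u` of an `ℝ^h`-valued function `u` in the direction of a tangent vector `X`
at `x`. -/
def dirDeriv {h : ℕ} {x : M} (X : TangentSpace I x) (u : M → Fin h → ℝ) : Fin h → ℝ :=
  fun a => mvfderiv I (fun y => u y a) x X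

/-- The `1`-form `u · dv = ∑ₐ uᵃ dvᵃ`. -/
def dotD {h : ℕ} (u v : M → Fin h → ℝ) (x : M) : Cotangent I x :=
  ∑ a, u x a • mvfderiv I (fun y => v y a) x

variable {I} in
/-- `i(X) θ = θ(X, ·)` for a bilinear alternating form. -/
def contract₂ {x : M} (θ : TangentSpace I x [⋀^Fin 2]→L[ℝ] ℝ) (X : TangentSpace I x) :
    Cotangent I x :=
  θ.toContinuousMultilinearMap.toContinuousLinearMap ![X, 0] 1

variable {I} in
/-- `i(X ∧ Y) θ = θ(X, Y, ·)` for a trilinear alternating form. -/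
def contract₃ {x : M} (θ : TangentSpace I x [⋀^Fin 3]→L[ℝ] ℝ) (X Y : TangentSpace I x) :
    Cotangent I x :=
  θ.toContinuousMultilinearMap.toContinuousLinearMap ![X, Y, 0] 2

/-! ### Twist forms -/

/-- The (rough) differential forms of degree `n` on `M`. -/
abbrev Form (M : Type*) [TopologicalSpace M] [ChartedSpace H M] (n : ℕ) : Type _ :=
  ∀ x : M, TangentSpace I x [⋀^Fin n]→L[ℝ] ℝ

variable {I} in
/-- The expression of a differential form in the preferred chart at `x₀`, that is, its pull-back
by the inverse of the chart. -/
def chartForm {n : ℕ} (θ : Form I M n) (x₀ : M) (y : E) : E [⋀^Fin n]→L[ℝ] ℝ :=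
  (θ ((extChartAt I x₀).symm y)).compContinuousLinearMap
    (mfderivWithin 𝓘(ℝ, E) I (extChartAt I x₀).symm (Set.range I) y)

variable {I} in
/-- A form is smooth and closed, expressed in the charts. -/
structure IsSmoothClosed {n : ℕ} (θ : Form I M n) : Prop where
  smooth : ∀ x₀ : M, ContDiffOn ℝ ∞ (chartForm θ x₀) (extChartAt I x₀).target
  closed : ∀ x₀ : M, ∀ y ∈ (extChartAt I x₀).target,
    extDerivWithin (chartForm θ x₀) (Set.range I) y = 0

variable {I} in
/-- The data `Φ, Ψ¹, …, Ψʰ` of the twist form `Φ + ∑ₐ dtᵃ ∧ Ψᵃ`: smooth closed forms on `M` of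
degree `3` and `2`. -/
structure IsTwist {h : ℕ} (Φ : Form I M 3) (Ψ : Fin h → Form I M 2) : Prop where
  form₃ : IsSmoothClosed Φ
  form₂ : ∀ a, IsSmoothClosed (Ψ a)

/-! ### The stable Courant bracket and stable Dirac structures -/

variable {I} in
/-- The stable Courant bracket of index `h` twisted by `Φ` and `Ψ`. -/
def bracket {h : ℕ} (Φ : Form I M 3) (Ψ : Fin h → Form I M 2) (s₁ s₂ : Section I M h) :
    Section I M h :=
  let X₁ := fun x => (s₁ x).1.1
  let u₁ := fun x => (s₁ x).1.2
  let α₁ := fun x => (s₁ x).2.1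
  let v₁ := fun x => (s₁ x).2.2
  let X₂ := fun x => (s₂ x).1.1
  let u₂ := fun x => (s₂ x).1.2
  let α₂ := fun x => (s₂ x).2.1
  let v₂ := fun x => (s₂ x).2.2
  fun x =>
    ((VectorField.mlieBracket I X₁ X₂ x, dirDeriv (X₁ x) u₂ - dirDeriv (X₂ x) u₁),
     (lieDerivForm I X₁ α₂ x - lieDerivForm I X₂ α₁ x
        + (1 / 2 : ℝ) • mvfderiv I (fun y => α₁ y (X₂ y) - α₂ y (X₁ y)) x
        + contract₃ (Φ x) (X₁ x) (X₂ x)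
        + ∑ a, u₁ x a • contract₂ (Ψ a x) (X₂ x)
        - ∑ a, u₂ x a • contract₂ (Ψ a x) (X₁ x)
        + (1 / 2 : ℝ) • (dotD I u₂ v₁ x + dotD I v₂ u₁ x - dotD I u₁ v₂ x - dotD I v₁ u₂ x),
      dirDeriv (X₁ x) v₂ - dirDeriv (X₂ x) v₁ + fun a => Ψ a x ![X₁ x, X₂ x]))

variable {I} in
/-- A stable Dirac structure of index `h`, twisted by `Φ` and `Ψ`: a stable almost Dirac structure
whose space of sections is closed under the twisted bracket. -/
structure IsTwistedDirac [IsManifold I ∞ M] {h : ℕ} (Φ : Form I M 3) (Ψ : Fin h → Form I M 2)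
    (L : Family I M h) : Prop where
  twist : IsTwist Φ Ψ
  almost : IsAlmostDirac I L
  integrable : ∀ s₁ s₂, IsSectionOf L s₁ → IsSectionOf L s₂ →
    IsSectionOf L (bracket Φ Ψ s₁ s₂)

variable {I} in
/-- An untwisted stable Dirac structure of index `h`: a stable almost Dirac structure
whose space of sections is closed under the untwisted bracket. -/
structure IsUntwistedDirac [IsManifold I ∞ M] {h : ℕ} (L : Family I M h) : Prop where
  almost : IsAlmostDirac I L
  integrable : ∀ s₁ s₂, IsSectionOf L s₁ → IsSectionOf L s₂ →
    IsSectionOf L (bracket (fun _ => 0) (fun _ _ => 0) s₁ s₂)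

variable {I} in
/-- The Lie derivative `(L_V X, V u) ⊕ (L_V α, V v)` of a section along the vector field `V`. -/
def lieDerivSection {h : ℕ} (V : ∀ x : M, TangentSpace I x) (s : Section I M h) :
    Section I M h := fun x =>
  ((VectorField.mlieBracket I V (fun y => (s y).1.1) x, dirDeriv (V x) (fun y => (s y).1.2)),
   (lieDerivForm I V (fun y => (s y).2.1) x, dirDeriv (V x) (fun y => (s y).2.2)))

variable {I} in
/-- The smooth vector field `V` is an infinitesimal automorphism of `L`: the Lie derivative
along `V` preserves the space of sections of `L`. -/
structure IsInfinitesimalAutomorphism [IsManifold I ∞ M] {h : ℕ} (V : ∀ x : M, TangentSpace I x)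
    (L : Family I M h) : Prop where
  smooth : ContMDiff I I.tangent ∞ (fun x => (⟨x, V x⟩ : TangentBundle I M))
  lie_mem : ∀ s, IsSectionOf L s → IsSectionOf L (lieDerivSection V s)

/-! ### The prolongation -/

variable {I} in
/-- The prolongation
`L̂ₓ = {(X - w·V(x), u, α(V(x))) ⊕ (α, v, w) | (X, u) ⊕ (α, v) ∈ Lₓ, w ∈ ℝ^k}`. -/
def prolong {h k : ℕ} (L : Family I M h) (V : Fin k → ∀ x : M, TangentSpace I x) :
    Family I M (h + k) := fun x =>
  { carrier := {ξ | ∃ (X : TangentSpace I x) (u : Fin h → ℝ) (α : Cotangent I x)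
      (v : Fin h → ℝ) (w : Fin k → ℝ), ((X, u), (α, v)) ∈ L x ∧
      ξ = ((X - ∑ p, w p • V p x, Fin.append u (fun p => α (V p x))), (α, Fin.append v w))}
    zero_mem' := by
      refine ⟨0, 0, 0, 0, 0, (L x).zero_mem, ?_⟩
      refine Prod.ext (Prod.ext ?_ ?_) (Prod.ext ?_ ?_)
      · simp
      · funext i; refine Fin.addCases (fun j => ?_) (fun j => ?_) i <;> simp
      · rfl
      · funext i; refine Fin.addCases (fun j => ?_) (fun j => ?_) i <;> simp
    add_mem' := by
      rintro _ _ ⟨X, u, α, v, w, hL, rfl⟩ ⟨X', u', α', v', w', hL', rfl⟩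
      refine ⟨X + X', u + u', α + α', v + v', w + w', (L x).add_mem hL hL', ?_⟩
      refine Prod.ext (Prod.ext ?_ ?_) (Prod.ext ?_ ?_)
      · simp only [Prod.fst_add, Pi.add_apply, add_smul, Finset.sum_add_distrib]; abel
      · funext i; refine Fin.addCases (fun j => ?_) (fun j => ?_) i <;> simp
      · rfl
      · funext i; refine Fin.addCases (fun j => ?_) (fun j => ?_) i <;> simp
    smul_mem' := by
      rintro c _ ⟨X, u, α, v, w, hL, rfl⟩
      refine ⟨c • X, c • u, c • α, c • v, c • w, (L x).smul_mem c hL, ?_⟩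
      refine Prod.ext (Prod.ext ?_ ?_) (Prod.ext ?_ ?_)
      · simp only [Prod.smul_fst, Pi.smul_apply, smul_sub, Finset.smul_sum, smul_smul, smul_eq_mul]
      · funext i; refine Fin.addCases (fun j => ?_) (fun j => ?_) i <;> simp
      · rfl
      · funext i; refine Fin.addCases (fun j => ?_) (fun j => ?_) i <;> simp }

variable {I} in
/-- The family `Ψ¹, …, Ψʰ` of `2`-forms with `k` zero forms appended. -/
def extendZero {h : ℕ} (k : ℕ) (Ψ : Fin h → Form I M 2) : Fin (h + k) → Form I M 2 :=
  Fin.append Ψ (fun _ _ => 0)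

end Manifold

end StableDirac

end

noncomputable section

namespace StableDirac

open VectorField

/-! ### Lie brackets and smoothness for fields of the form `X - ∑ w p • V p` -/

section

variable {E : Type*} [NormedAddCommGroup E] [NormedSpace ℝ E]
  {H : Type*} [TopologicalSpace H] {I : ModelWithCorners ℝ E H}
  {M : Type*} [TopologicalSpace M] [ChartedSpace H M]

/-! At each point the prolongation is the image of `L x × ℝ^k` under the injective linear map `(ξ,
w) ↦ liftFibre V ξ w`. This map does not change the metric (`metric_liftFibre`): the term `-w·α(V)`
from the tangent part cancels `w·α(V)` from the added components. So the image is isotropic. It is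
maximal because pairing with the lift of `(0, e_p)` forces an orthogonal vector to be a lift, of a
vector that maximality puts in `L x`. A frame of `L` together with the vectors `e_p` lifts to a
frame.

For integrability, the sections of the prolongation are exactly the lifts of pairs `(s, w)` with `s
∈ Γ L` and `w` smooth. The core is `bracket_liftFibre`: the bracket of the lifts of `(s₁, w₁)` and
`(s₂, w₂)` is the lift of `[s₁, s₂] + ∑ (w₂ᵖ L_{V_p} s₁ - w₁ᵖ L_{V_p} s₂)` with coefficients `Y₁ w₂
- Y₂ w₁`, where `Yᵢ` is the tangent part of the lift of `(sᵢ, wᵢ)`. The new section lies in `L` by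
integrability and by the automorphism property.

Vanishing brackets `[V_p, V_q]` enter in the tangent part and in the components `α(V_p)`. The latter
also need the 1-form `β` of `[s₁, s₂]` to satisfy `β(V) = X₁(α₂(V)) - X₂(α₁(V))`
(`bracket_form_apply`); the defect is `G(L_V s₁, s₂) - G(L_V s₂, s₁)`, zero by isotropy. The
conditions `i(V_p)Φ = 0` and `i(V_p)Ψᵃ = 0` make the twist terms blind to `w·V`. -/

theorem mdifferentiableAt_sub_sum [IsManifold I 1 M] {ι : Type*} (t : Finset ι)
    {X : ∀ x : M, TangentSpace I x} {V : ι → ∀ x : M, TangentSpace I x} {w : ι → M → ℝ} {x : M}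
    (hX : MDifferentiableAt I I.tangent (fun y => (⟨y, X y⟩ : TangentBundle I M)) x)
    (hV : ∀ p, MDifferentiableAt I I.tangent (fun y => (⟨y, V p y⟩ : TangentBundle I M)) x)
    (hw : ∀ p, MDifferentiableAt I 𝓘(ℝ, ℝ) (w p) x) :
    MDifferentiableAt I I.tangent
      (fun y => (⟨y, X y - ∑ p ∈ t, w p y • V p y⟩ : TangentBundle I M)) x := by
  classical
  induction t using Finset.induction_on with
  | empty => simpa using hX
  | insert a t ha ih =>
    have := mdifferentiableAt_sub_section ih ((hw a).smul_section (hV a))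
    convert this using 3 with y
    simp [Finset.sum_insert ha]
    abel

theorem mlieBracket_sub_sum_left [CompleteSpace E] [IsManifold I 2 M] {ι : Type*} (t : Finset ι)
    {X Y : ∀ x : M, TangentSpace I x}
    {V : ι → ∀ x : M, TangentSpace I x} {w : ι → M → ℝ} {x : M}
    (hX : MDifferentiableAt I I.tangent (fun y => (⟨y, X y⟩ : TangentBundle I M)) x)
    (hV : ∀ p, MDifferentiableAt I I.tangent (fun y => (⟨y, V p y⟩ : TangentBundle I M)) x)
    (hw : ∀ p, MDifferentiableAt I 𝓘(ℝ, ℝ) (w p) x) :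
    mlieBracket I (fun y => X y - ∑ p ∈ t, w p y • V p y) Y x
      = mlieBracket I X Y x -
        ∑ p ∈ t, (w p x • mlieBracket I (V p) Y x - mvfderiv I (w p) x (Y x) • V p x) := by
  classical
  have : IsManifold I 1 M := .of_le (n := 2) one_le_two
  induction t using Finset.induction_on with
  | empty => simp
  | insert a t ha ih =>
    have e : (fun y => X y - ∑ p ∈ insert a t, w p y • V p y)
        = (fun y => X y - ∑ p ∈ t, w p y • V p y) + (-w a) • V a := by
      ext y
      simp [Finset.sum_insert ha]
      abel
    have hs : MDifferentiableAt I I.tangent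
        (fun y => (⟨y, ((-w a) • V a) y⟩ : TangentBundle I M)) x :=
      (hw a).neg.smul_section (hV a)
    rw [e, mlieBracket_add_left (mdifferentiableAt_sub_sum t hX hV hw) hs,
      mlieBracket_smul_left (hw a).neg (hV a), ih, Finset.sum_insert ha, mvfderiv_neg]
    simp
    abel

theorem mlieBracket_sub_sum_right [CompleteSpace E] [IsManifold I 2 M] {ι : Type*} (t : Finset ι)
    {X Y : ∀ x : M, TangentSpace I x}
    {V : ι → ∀ x : M, TangentSpace I x} {w : ι → M → ℝ} {x : M}
    (hX : MDifferentiableAt I I.tangent (fun y => (⟨y, X y⟩ : TangentBundle I M)) x)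
    (hV : ∀ p, MDifferentiableAt I I.tangent (fun y => (⟨y, V p y⟩ : TangentBundle I M)) x)
    (hw : ∀ p, MDifferentiableAt I 𝓘(ℝ, ℝ) (w p) x) :
    mlieBracket I Y (fun y => X y - ∑ p ∈ t, w p y • V p y) x
      = mlieBracket I Y X x -
        ∑ p ∈ t, (w p x • mlieBracket I Y (V p) x + mvfderiv I (w p) x (Y x) • V p x) := by
  have h : ∀ p, mlieBracket I (V p) Y x = -mlieBracket I Y (V p) x :=
    fun p => mlieBracket_swap_apply
  rw [mlieBracket_swap_apply, mlieBracket_sub_sum_left t hX hV hw,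
    mlieBracket_swap_apply (V := X)]
  simp only [h, smul_neg, Finset.sum_add_distrib, Finset.sum_sub_distrib, Finset.sum_neg_distrib]
  abel

variable [IsManifold I ∞ M]

theorem pairing_mdifferentiableAt {α : ∀ x : M, Cotangent I x}
    {Y : ∀ x : M, TangentSpace I x} {x : M}
    (hα : MDifferentiableAt I (I.prod 𝓘(ℝ, E →L[ℝ] ℝ))
    (fun x => Bundle.TotalSpace.mk' (E →L[ℝ] ℝ) (E := fun y : M => (TangentSpace I y →L[ℝ] ℝ))
      x (α x)) x)
    (hY : MDifferentiableAt I I.tangent (fun y => (⟨y, Y y⟩ : TangentBundle I M)) x) :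
    MDifferentiableAt I 𝓘(ℝ, ℝ) (fun y => α y (Y y)) x := by
  -- A 1-form is a bundle map from the tangent bundle to the trivial line bundle; the function is
  -- the fibre coordinate of its value.
  have := MDifferentiableAt.clm_bundle_apply (F₁ := E) (F₂ := ℝ)
    (E₁ := fun y : M => TangentSpace I y) (E₂ := fun y : M => Bundle.Trivial M ℝ y) hα hY
  exact ((mdifferentiableAt_totalSpace ..).1 this).2

theorem pairing_contMDiffOn {α : ∀ x : M, Cotangent I x}
    {Y : ∀ x : M, TangentSpace I x} {U : Set M}
    (hα : ContMDiffOn I (I.prod 𝓘(ℝ, E →L[ℝ] ℝ)) ∞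
    (fun x => Bundle.TotalSpace.mk' (E →L[ℝ] ℝ) (E := fun y : M => (TangentSpace I y →L[ℝ] ℝ))
      x (α x)) U)
    (hY : ContMDiffOn I I.tangent ∞ (fun y => (⟨y, Y y⟩ : TangentBundle I M)) U) :
    ContMDiffOn I 𝓘(ℝ, ℝ) ∞ (fun y => α y (Y y)) U := by
  have := ContMDiffOn.clm_bundle_apply (F₁ := E) (F₂ := ℝ)
    (E₁ := fun y : M => TangentSpace I y) (E₂ := fun y : M => Bundle.Trivial M ℝ y) hα hY
  exact fun x hx => (Bundle.contMDiffWithinAt_totalSpace.1 (this x hx)).2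

/-- `X f` is the fibre coordinate of the composite of `X : M → TM` with the tangent map of `f`. -/
theorem mvfderiv_apply_contMDiff {f : M → ℝ} {X : ∀ x : M, TangentSpace I x}
    (hf : ContMDiff I 𝓘(ℝ, ℝ) ∞ f)
    (hX : ContMDiff I I.tangent ∞ (fun y => (⟨y, X y⟩ : TangentBundle I M))) :
    ContMDiff I 𝓘(ℝ, ℝ) ∞ (fun y => mvfderiv I f y (X y)) := by
  have h := (hf.contMDiff_tangentMap (m := ∞) le_rfl).comp hX
  exact (contMDiff_snd_tangentBundle_modelSpace ℝ 𝓘(ℝ, ℝ)).comp h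

end

/-! ### Lie derivatives of 1-forms, computed in the preferred chart -/

section

variable {E : Type*} [NormedAddCommGroup E] [NormedSpace ℝ E]
  {H : Type*} [TopologicalSpace H] {I : ModelWithCorners ℝ E H}
  {M : Type*} [TopologicalSpace M] [ChartedSpace H M] [IsManifold I ∞ M]

theorem fderivWithin_clm_apply_apply {F : Type*} [NormedAddCommGroup F] [NormedSpace ℝ F]
    {a : F → F →L[ℝ] ℝ} {Y : F → F} {s : Set F} {p : F}
    (hs : UniqueDiffWithinAt ℝ s p) (ha : DifferentiableWithinAt ℝ a s p)
    (hY : DifferentiableWithinAt ℝ Y s p) (v : F) :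
    fderivWithin ℝ (fun y => a y (Y y)) s p v =
      a p (fderivWithin ℝ Y s p v) + fderivWithin ℝ a s p v (Y p) := by
  rw [fderivWithin_clm_apply hs ha hY]
  simp

theorem fderivWithin_sub_smul_apply {F : Type*} [NormedAddCommGroup F] [NormedSpace ℝ F]
    {X V : F → F} {f : F → ℝ} {s : Set F} {p : F}
    (hs : UniqueDiffWithinAt ℝ s p) (hX : DifferentiableWithinAt ℝ X s p)
    (hf : DifferentiableWithinAt ℝ f s p) (hV : DifferentiableWithinAt ℝ V s p) (v : F) :
    fderivWithin ℝ (fun y => X y - f y • V y) s p v =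
      fderivWithin ℝ X s p v - (f p • fderivWithin ℝ V s p v + fderivWithin ℝ f s p v • V p) := by
  rw [(hX.hasFDerivWithinAt.fun_sub (hf.hasFDerivWithinAt.fun_smul
    hV.hasFDerivWithinAt)).fderivWithin hs]
  simp

/-- The expression of a `1`-form in the preferred chart at `x`. -/
def formInChart (α : ∀ x : M, Cotangent I x) (x : M) : E → E →L[ℝ] ℝ := fun y =>
  (α ((extChartAt I x).symm y)).comp
    (mfderivWithin 𝓘(ℝ, E) I (extChartAt I x).symm (Set.range I) y)

/-- The expression of a vector field in the preferred chart at `x`. -/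
def vecInChart (X : ∀ x : M, TangentSpace I x) (x : M) : E → E :=
  mpullbackWithin 𝓘(ℝ, E) I (extChartAt I x).symm X (Set.range I)

theorem differentiableWithinAt_formInChart {α : ∀ x : M, Cotangent I x} {x : M}
    (hα : MDifferentiableAt I (I.prod 𝓘(ℝ, E →L[ℝ] ℝ))
    (fun x => Bundle.TotalSpace.mk' (E →L[ℝ] ℝ) (E := fun y : M => (TangentSpace I y →L[ℝ] ℝ))
      x (α x)) x) :
    DifferentiableWithinAt ℝ (formInChart α x) (Set.range I) (extChartAt I x x) := by
  have h := ((mdifferentiableAt_hom_bundle (E₁ := fun y : M => TangentSpace I y)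
    (E₂ := fun y : M => Bundle.Trivial M ℝ y) _).1 hα).2
  have h2 := (mdifferentiableWithinAt_univ.2 h).differentiableWithinAt_comp_extChartAt_symm
  simp only [Set.preimage_univ, Set.univ_inter] at h2
  -- The inverse of the tangent trivialization is the derivative of the inverse chart, so on the
  -- chart target pull-back by the chart agrees with the coordinates of the hom bundle.
  have e : ∀ y ∈ (extChartAt I x).target, formInChart α x y =
      ContinuousLinearMap.inCoordinates E (fun y => TangentSpace I y) ℝ
        (fun y => Bundle.Trivial M ℝ y) x ((extChartAt I x).symm y) x ((extChartAt I x).symm y)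
        (α ((extChartAt I x).symm y)) := by
    intro y hy
    have hz : (extChartAt I x).symm y ∈ (chartAt H x).source := by
      rw [← extChartAt_source I]; exact (extChartAt I x).map_target hy
    have := TangentBundle.symmL_trivializationAt (𝕜 := ℝ) (I := I) hz
    rw [(extChartAt I x).right_inv hy] at this
    rw [ContinuousLinearMap.inCoordinates, this]
    ext v
    simp [formInChart]
  refine h2.congr_of_eventuallyEq ?_ (e _ (mem_extChartAt_target x))
  filter_upwards [extChartAt_target_mem_nhdsWithin x] with y hy
  exact e y hy

theorem differentiableWithinAt_vecInChart [CompleteSpace E] {X : ∀ x : M, TangentSpace I x} {x : M}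
    (hX : MDifferentiableAt I I.tangent (fun y => (⟨y, X y⟩ : TangentBundle I M)) x) :
    DifferentiableWithinAt ℝ (vecInChart X x) (Set.range I) (extChartAt I x x) := by
  have : IsManifold I 2 M := inferInstance
  have := (mdifferentiableWithinAt_univ.2 hX).differentiableWithinAt_mpullbackWithin_vectorField
  simpa only [Set.preimage_univ, Set.univ_inter] using! this

theorem vecInChart_self (X : ∀ x : M, TangentSpace I x) (x : M) :
    vecInChart X x (extChartAt I x x) = X x := by
  -- The fibre depends on the base point, so the equality of base points is substituted with `z` a
  -- variable, all fibres being read as `E`.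
  have h : ∀ z, z = x → (X z : E) = X x := by rintro z rfl; rfl
  simp only [vecInChart, mpullbackWithin_apply, mfderivWithin_range_extChartAt_symm]
  erw [ContinuousLinearMap.inverse_id]
  exact h _ (extChartAt_to_inv x)

theorem formInChart_self (α : ∀ x : M, Cotangent I x) (x : M) (v : E) :
    formInChart α x (extChartAt I x x) v = α x v := by
  have h : ∀ z, z = x → (α z : E →L[ℝ] ℝ) v = α x v := by rintro z rfl; rfl
  simp only [formInChart, mfderivWithin_range_extChartAt_symm]
  exact h _ (extChartAt_to_inv x)

/-- Pulling back the field uses the inverse of the derivative that pulls back the form, and the two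
cancel. Derivatives of `α(X)` thus become derivatives of a product in `E`. -/
theorem formInChart_vecInChart (α : ∀ x : M, Cotangent I x) (X : ∀ x : M, TangentSpace I x) (x : M)
    {y : E} (hy : y ∈ (extChartAt I x).target) :
    formInChart α x y (vecInChart X x y) =
      α ((extChartAt I x).symm y) (X ((extChartAt I x).symm y)) := by
  simp only [formInChart, vecInChart, mpullbackWithin_apply]
  have := (isInvertible_mfderivWithin_extChartAt_symm (I := I) hy).self_apply_inverse
    (X ((extChartAt I x).symm y))
  exact congrArg (α ((extChartAt I x).symm y)) this

/-- The derivative of the chart at its own base point is the identity, so all coordinate changes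
disappear there. -/
theorem lieDerivForm_eq (X : ∀ x : M, TangentSpace I x) (α : ∀ x : M, Cotangent I x) (x : M)
    (Z : TangentSpace I x) :
    lieDerivForm I X α x Z =
      fderivWithin ℝ (formInChart α x) (Set.range I) (extChartAt I x x) (X x) Z +
      α x (fderivWithin ℝ (vecInChart X x) (Set.range I) (extChartAt I x x) Z) := by
  have h : lieDerivForm I X α x Z =
      fderivWithin ℝ (formInChart α x) (Set.range I) (extChartAt I x x)
        (vecInChart X x (extChartAt I x x)) (mfderiv I 𝓘(ℝ, E) (extChartAt I x) x Z) +
      formInChart α x (extChartAt I x x)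
        (fderivWithin ℝ (vecInChart X x) (Set.range I) (extChartAt I x x)
          (mfderiv I 𝓘(ℝ, E) (extChartAt I x) x Z)) := rfl
  rw [h, vecInChart_self, formInChart_self, mfderiv_extChartAt_self]
  rfl

theorem mlieBracket_eq (X Y : ∀ x : M, TangentSpace I x) (x : M) :
    (mlieBracket I X Y x : E) =
      fderivWithin ℝ (vecInChart Y x) (Set.range I) (extChartAt I x x) (X x) -
      fderivWithin ℝ (vecInChart X x) (Set.range I) (extChartAt I x x) (Y x) := by
  have h : mlieBracket I X Y x = (mfderiv I 𝓘(ℝ, E) (extChartAt I x) x).inverse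
      (fderivWithin ℝ (vecInChart Y x) ((extChartAt I x).symm ⁻¹' Set.univ ∩ Set.range I)
        (extChartAt I x x) (vecInChart X x (extChartAt I x x)) -
      fderivWithin ℝ (vecInChart X x) ((extChartAt I x).symm ⁻¹' Set.univ ∩ Set.range I)
        (extChartAt I x x) (vecInChart Y x (extChartAt I x x))) := rfl
  rw [h, vecInChart_self, vecInChart_self, mfderiv_extChartAt_self]
  rw [Set.preimage_univ, Set.univ_inter]
  erw [ContinuousLinearMap.inverse_id]
  rfl

/-- Cartan's formula: the product rule for `α(Y)` in the chart, with the derivative of `Y` absorbed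
into the bracket. Later arguments use this in place of charts. -/
theorem lieDerivForm_apply [CompleteSpace E] {X Y : ∀ x : M, TangentSpace I x}
    {α : ∀ x : M, Cotangent I x} {x : M}
    (hY : MDifferentiableAt I I.tangent (fun y => (⟨y, Y y⟩ : TangentBundle I M)) x)
    (hα : MDifferentiableAt I (I.prod 𝓘(ℝ, E →L[ℝ] ℝ))
    (fun x => Bundle.TotalSpace.mk' (E →L[ℝ] ℝ) (E := fun y : M => (TangentSpace I y →L[ℝ] ℝ))
      x (α x)) x) :
    lieDerivForm I X α x (Y x) =
      mvfderiv I (fun y => α y (Y y)) x (X x) - α x (mlieBracket I X Y x) := by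
  have hu : UniqueDiffWithinAt ℝ (Set.range I) (extChartAt I x x) :=
    I.uniqueDiffOn.uniqueDiffWithinAt (Set.mem_range_self (chartAt H x x))
  have h2 : mvfderiv I (fun y => α y (Y y)) x (X x) =
      fderivWithin ℝ (fun y => formInChart α x y (vecInChart Y x y)) (Set.range I)
        (extChartAt I x x) (X x) := by
    rw [(pairing_mdifferentiableAt hα hY).mvfderiv]
    congr 1
    refine Filter.EventuallyEq.fderivWithin_eq ?_ ?_
    · filter_upwards [extChartAt_target_mem_nhdsWithin x] with y hy
      rw [formInChart_vecInChart α Y x hy]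
      rfl
    · rw [formInChart_vecInChart α Y x (mem_extChartAt_target x)]
      rfl
  have h3 := fderivWithin_clm_apply_apply hu (differentiableWithinAt_formInChart hα)
    (differentiableWithinAt_vecInChart hY) (X x)
  rw [formInChart_self, vecInChart_self] at h3
  have h4 : α x (mlieBracket I X Y x) =
      α x (fderivWithin ℝ (vecInChart Y x) (Set.range I) (extChartAt I x x) (X x)) -
      α x (fderivWithin ℝ (vecInChart X x) (Set.range I) (extChartAt I x x) (Y x)) :=
    (congrArg (α x) (mlieBracket_eq X Y x)).trans (map_sub (α x) _ _)
  rw [lieDerivForm_eq, h2, h4]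
  refine Eq.trans ?_ (congrArg (· - _) h3.symm)
  ring

/-- No regularity of `α` is needed: its chart derivative enters only through its value in the
direction of the field, which is linear. The term in `df` comes from differentiating `f • V`. -/
theorem lieDerivForm_sub_smul [CompleteSpace E] {X V : ∀ x : M, TangentSpace I x}
    {α : ∀ x : M, Cotangent I x} {f : M → ℝ} {x : M}
    (hX : MDifferentiableAt I I.tangent (fun y => (⟨y, X y⟩ : TangentBundle I M)) x)
    (hV : MDifferentiableAt I I.tangent (fun y => (⟨y, V y⟩ : TangentBundle I M)) x)
    (hf : MDifferentiableAt I 𝓘(ℝ, ℝ) f x) :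
    lieDerivForm I (fun y => X y - f y • V y) α x =
      lieDerivForm I X α x - (f x • lieDerivForm I V α x + α x (V x) • mvfderiv I f x) := by
  have hu : UniqueDiffWithinAt ℝ (Set.range I) (extChartAt I x x) :=
    I.uniqueDiffOn.uniqueDiffWithinAt (Set.mem_range_self (chartAt H x x))
  have e : vecInChart (fun y => X y - f y • V y) x =
      fun y => vecInChart X x y - (f ∘ (extChartAt I x).symm) y • vecInChart V x y := by
    ext y
    simp only [vecInChart, mpullbackWithin_apply]
    exact (map_sub _ _ _).trans (congrArg _ (map_smul _ _ _))
  have hf' := (mdifferentiableWithinAt_univ.2 hf).differentiableWithinAt_comp_extChartAt_symm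
  simp only [Set.preimage_univ, Set.univ_inter] at hf'
  have h1 := fderivWithin_sub_smul_apply hu (differentiableWithinAt_vecInChart hX) hf'
    (differentiableWithinAt_vecInChart hV)
  ext Z
  have h2 : mvfderiv I f x Z = fderivWithin ℝ (f ∘ (extChartAt I x).symm) (Set.range I)
        (extChartAt I x x) Z := by
    rw [hf.mvfderiv]; rfl
  have h3 : ∀ v w y : E, ∀ a b : ℝ, α x (v - (a • w + b • y)) = α x v - (a * α x w + b * α x y) :=
    fun v w y a b => by
      refine (map_sub (α x) _ _).trans (congrArg _ ((map_add (α x) _ _).trans ?_))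
      exact congrArg₂ _ (map_smul (α x) _ _) (map_smul (α x) _ _)
  have h4 : ∀ B : E →L[ℝ] E →L[ℝ] ℝ, ∀ v w : E, ∀ a : ℝ,
      B (v - a • w) Z = B v Z - a * B w Z := fun B v w a => by
    rw [map_sub, map_smul]; rfl
  have h5 : f ((extChartAt I x).symm (extChartAt I x x)) = f x := by rw [extChartAt_to_inv]
  have h6 : (lieDerivForm I X α x - (f x • lieDerivForm I V α x + α x (V x) • mvfderiv I f x)) Z
      = lieDerivForm I X α x Z - (f x * lieDerivForm I V α x Z + α x (V x) * mvfderiv I f x Z) :=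
    rfl
  rw [h6, h2, lieDerivForm_eq, lieDerivForm_eq, lieDerivForm_eq, e]
  refine (congrArg₂ (· + ·) (h4 _ (X x) (V x) (f x))
    ((congrArg (α x) (h1 Z)).trans (h3 _ _ _ _ _))).trans ?_
  rw [vecInChart_self]
  simp only [Function.comp_apply]
  rw [h5]
  ring

theorem lieDerivForm_sub_sum [CompleteSpace E] {ι : Type*} (t : Finset ι)
    {X : ∀ x : M, TangentSpace I x} {V : ι → ∀ x : M, TangentSpace I x}
    {α : ∀ x : M, Cotangent I x} {w : ι → M → ℝ} {x : M}
    (hX : MDifferentiableAt I I.tangent (fun y => (⟨y, X y⟩ : TangentBundle I M)) x)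
    (hV : ∀ p, MDifferentiableAt I I.tangent (fun y => (⟨y, V p y⟩ : TangentBundle I M)) x)
    (hw : ∀ p, MDifferentiableAt I 𝓘(ℝ, ℝ) (w p) x) :
    lieDerivForm I (fun y => X y - ∑ p ∈ t, w p y • V p y) α x =
      lieDerivForm I X α x -
        ∑ p ∈ t, (w p x • lieDerivForm I (V p) α x + α x (V p x) • mvfderiv I (w p) x) := by
  classical
  induction t using Finset.induction_on with
  | empty => simp
  | insert a t ha ih =>
    have e : (fun y => X y - ∑ p ∈ insert a t, w p y • V p y)
        = fun y => (X y - ∑ p ∈ t, w p y • V p y) - w a y • V a y := by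
      ext y
      rw [Finset.sum_insert ha]
      abel
    rw [e, lieDerivForm_sub_smul (mdifferentiableAt_sub_sum t hX hV hw) (hV a) (hw a), ih,
      Finset.sum_insert ha]
    abel

end

/-! ### The lift on fibres: isometry, maximal isotropy, smooth frames -/

section

variable {E : Type*} [NormedAddCommGroup E] [NormedSpace ℝ E]
  {H : Type*} [TopologicalSpace H] {I : ModelWithCorners ℝ E H}
  {M : Type*} [TopologicalSpace M] [ChartedSpace H M]

theorem fibre_ext {h : ℕ} {x : M} {ξ η : Fibre I h x} (h₁ : ξ.1.1 = η.1.1)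
    (h₂ : ξ.1.2 = η.1.2) (h₃ : ξ.2.1 = η.2.1) (h₄ : ξ.2.2 = η.2.2) : ξ = η :=
  Prod.ext (Prod.ext h₁ h₂) (Prod.ext h₃ h₄)

/-- The element `(X - w·V(x), u, α(V(x))) ⊕ (α, v, w)` of the fibre of index `h + k`. -/
def liftFibre {h k : ℕ} (V : Fin k → ∀ x : M, TangentSpace I x) {x : M} (ξ : Fibre I h x)
    (w : Fin k → ℝ) : Fibre I (h + k) x :=
  ((ξ.1.1 - ∑ p, w p • V p x, Fin.append ξ.1.2 (fun p => ξ.2.1 (V p x))),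
    (ξ.2.1, Fin.append ξ.2.2 w))

/-- The element `(Y + w·V(x), u) ⊕ (β, v)` obtained from `(Y, u, b) ⊕ (β, v, w)`. -/
def lowerFibre {h k : ℕ} (V : Fin k → ∀ x : M, TangentSpace I x) {x : M}
    (ξ : Fibre I (h + k) x) : Fibre I h x :=
  ((ξ.1.1 + ∑ p, ξ.2.2 (Fin.natAdd h p) • V p x, fun a => ξ.1.2 (Fin.castAdd k a)),
    (ξ.2.1, fun a => ξ.2.2 (Fin.castAdd k a)))

section Fibrewise

variable {h k : ℕ} (V : Fin k → ∀ x : M, TangentSpace I x) {x : M}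

theorem mem_prolong {L : Family I M h} {ξ : Fibre I (h + k) x} :
    ξ ∈ prolong L V x ↔ ∃ η ∈ L x, ∃ w, ξ = liftFibre V η w := by
  constructor
  · rintro ⟨X, u, α, v, w, hL, rfl⟩
    exact ⟨((X, u), (α, v)), hL, w, rfl⟩
  · rintro ⟨⟨⟨X, u⟩, ⟨α, v⟩⟩, hL, w, rfl⟩
    exact ⟨X, u, α, v, w, hL, rfl⟩

theorem lowerFibre_liftFibre (ξ : Fibre I h x) (w : Fin k → ℝ) :
    lowerFibre V (liftFibre V ξ w) = ξ := by
  apply fibre_ext <;> simp [lowerFibre, liftFibre]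

theorem liftFibre_lowerFibre {ξ : Fibre I (h + k) x}
    (hξ : ∀ p, ξ.1.2 (Fin.natAdd h p) = ξ.2.1 (V p x)) :
    liftFibre V (lowerFibre V ξ) (fun p => ξ.2.2 (Fin.natAdd h p)) = ξ := by
  apply fibre_ext
  · simp [lowerFibre, liftFibre]
  · funext i
    refine Fin.addCases (fun j => ?_) (fun j => ?_) i <;> simp [lowerFibre, liftFibre, hξ]
  · rfl
  · funext i
    refine Fin.addCases (fun j => ?_) (fun j => ?_) i <;> simp [lowerFibre, liftFibre]

/-- The linear map `(ξ, w) ↦ liftFibre V ξ w`. -/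
def liftLinear (h : ℕ) (x : M) : (Fibre I h x × (Fin k → ℝ)) →ₗ[ℝ] Fibre I (h + k) x where
  toFun η := liftFibre V η.1 η.2
  map_add' η η' := by
    apply fibre_ext
    · simp only [liftFibre, Prod.fst_add, Prod.snd_add, Pi.add_apply, add_smul,
        Finset.sum_add_distrib]
      abel
    · funext i
      refine Fin.addCases (fun j => ?_) (fun j => ?_) i <;> simp [liftFibre]
    · rfl
    · funext i
      refine Fin.addCases (fun j => ?_) (fun j => ?_) i <;> simp [liftFibre]
  map_smul' c η := by
    apply fibre_ext
    · simp [liftFibre, smul_sub, Finset.smul_sum, smul_smul]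
    · funext i
      refine Fin.addCases (fun j => ?_) (fun j => ?_) i <;> simp [liftFibre]
    · rfl
    · funext i
      refine Fin.addCases (fun j => ?_) (fun j => ?_) i <;> simp [liftFibre]

theorem liftLinear_injective : Function.Injective (liftLinear V h x) := by
  intro η η' e
  have e' : liftFibre V η.1 η.2 = liftFibre V η'.1 η'.2 := e
  refine Prod.ext ?_ ?_
  · rw [← lowerFibre_liftFibre V η.1 η.2, e', lowerFibre_liftFibre]
  · funext p
    simpa [liftFibre] using congrArg (fun ζ : Fibre I (h + k) x => ζ.2.2 (Fin.natAdd h p)) e'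

theorem prolong_eq_map (L : Family I M h) :
    prolong L V x = ((L x).prod ⊤).map (liftLinear V h x) := by
  ext ξ
  rw [mem_prolong, Submodule.mem_map]
  constructor
  · rintro ⟨η, hη, w, rfl⟩; exact ⟨(η, w), ⟨hη, trivial⟩, rfl⟩
  · rintro ⟨⟨η, w⟩, ⟨hη, -⟩, rfl⟩; exact ⟨η, hη, w, rfl⟩

theorem metric_liftFibre (ξ η : Fibre I h x) (w w' : Fin k → ℝ) :
    metric (liftFibre V ξ w) (liftFibre V η w') = metric ξ η := by
  simp only [metric, liftFibre, map_sub, map_sum, map_smul, smul_eq_mul, dotProduct,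
    Fin.sum_univ_add, Fin.append_left, Fin.append_right]
  have e : ∀ (a b : Fin k → ℝ), ∑ p, a p * b p = ∑ p, b p * a p := fun a b =>
    Finset.sum_congr rfl fun p _ => mul_comm _ _
  rw [e w, e w']
  ring

theorem metric_comm (ξ η : Fibre I h x) : metric ξ η = metric η ξ := by
  simp only [metric, dotProduct]
  ring

theorem metric_add_smul (ξ η ζ : Fibre I h x) (c : ℝ) :
    metric ξ (η + c • ζ) = metric ξ η + c * metric ξ ζ := by
  simp only [metric, dotProduct, Prod.fst_add, Prod.snd_add, Prod.smul_fst, Prod.smul_snd,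
    map_add, map_smul, Pi.add_apply, Pi.smul_apply, smul_eq_mul, mul_add, add_mul,
    Finset.sum_add_distrib, add_apply, smul_apply]
  have e₁ : ∑ i, ξ.1.2 i * (c * ζ.2.2 i) = c * ∑ i, ξ.1.2 i * ζ.2.2 i := by
    rw [Finset.mul_sum]; exact Finset.sum_congr rfl fun _ _ => by ring
  have e₂ : ∑ i, c * ζ.1.2 i * ξ.2.2 i = c * ∑ i, ζ.1.2 i * ξ.2.2 i := by
    rw [Finset.mul_sum]; exact Finset.sum_congr rfl fun _ _ => by ring
  rw [e₁, e₂]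
  ring

/-- Adjoining `ζ` to `N` keeps the subspace isotropic, so maximality absorbs it. -/
theorem mem_of_maximal_isIsotropic {N : Submodule ℝ (Fibre I h x)} (hN : Maximal IsIsotropic N)
    {ζ : Fibre I h x} (h₀ : metric ζ ζ = 0) (h₁ : ∀ η ∈ N, metric η ζ = 0) : ζ ∈ N := by
  have hiso : IsIsotropic (N ⊔ Submodule.span ℝ {ζ}) := by
    intro ξ hξ η hη
    obtain ⟨a, ha, b, hb, rfl⟩ := Submodule.mem_sup.1 hξ
    obtain ⟨a', ha', b', hb', rfl⟩ := Submodule.mem_sup.1 hη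
    obtain ⟨c, rfl⟩ := Submodule.mem_span_singleton.1 hb
    obtain ⟨c', rfl⟩ := Submodule.mem_span_singleton.1 hb'
    rw [metric_add_smul, metric_comm, metric_comm _ ζ, metric_add_smul, metric_add_smul,
      hN.prop a' ha' a ha, h₁ a' ha', metric_comm ζ a, h₁ a ha, h₀]
    simp
  exact hN.2 hiso le_sup_left (Submodule.mem_sup_right (Submodule.mem_span_singleton_self ζ))

theorem maximal_isIsotropic_prolong {L : Family I M h} (hL : Maximal IsIsotropic (L x)) :
    Maximal IsIsotropic (prolong L V x) := by
  refine ⟨?_, ?_⟩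
  · intro ξ hξ η hη
    obtain ⟨ξ', hξ', w, rfl⟩ := (mem_prolong V).1 hξ
    obtain ⟨η', hη', w', rfl⟩ := (mem_prolong V).1 hη
    rw [metric_liftFibre]
    exact hL.prop _ hξ' _ hη'
  · intro N hN hle ξ hξ
    have hb : ∀ p, ξ.1.2 (Fin.natAdd h p) = ξ.2.1 (V p x) := by
      intro p
      -- This lift is `(-V_p, 0, 0) ⊕ (0, 0, e_p)`; its pairing with `ξ` is half the difference of
      -- the two sides of the goal.
      have hm := hN (liftFibre V 0 (Pi.single p 1))
        (hle ((mem_prolong V).2 ⟨0, (L x).zero_mem, _, rfl⟩)) ξ hξ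
      simp [metric, liftFibre, dotProduct, Fin.sum_univ_add, Pi.single_apply] at hm
      linarith
    have e := liftFibre_lowerFibre V hb
    refine (mem_prolong V).2 ⟨lowerFibre V ξ, ?_, _, e.symm⟩
    refine mem_of_maximal_isIsotropic hL ?_ ?_
    · rw [← metric_liftFibre V _ _ (fun p => ξ.2.2 (Fin.natAdd h p))
        (fun p => ξ.2.2 (Fin.natAdd h p)), e]
      exact hN ξ hξ ξ hξ
    · intro η hη
      rw [← metric_liftFibre V _ _ 0 (fun p => ξ.2.2 (Fin.natAdd h p)), e]
      exact hN _ (hle ((mem_prolong V).2 ⟨η, hη, _, rfl⟩)) ξ hξ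

end Fibrewise

section Smooth

variable {h k : ℕ} {U : Set M}

theorem contMDiffOn_append {u : M → Fin h → ℝ} {w : M → Fin k → ℝ}
    (hu : ContMDiffOn I 𝓘(ℝ, Fin h → ℝ) ∞ u U) (hw : ContMDiffOn I 𝓘(ℝ, Fin k → ℝ) ∞ w U) :
    ContMDiffOn I 𝓘(ℝ, Fin (h + k) → ℝ) ∞ (fun x => Fin.append (u x) (w x)) U := by
  rw [contMDiffOn_pi_space] at hu hw ⊢
  intro i
  refine Fin.addCases (fun j => ?_) (fun j => ?_) i
  · simpa using hu j
  · simpa using hw j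

variable [IsManifold I ∞ M]

theorem SmoothOn.zero : SmoothOn (fun _ => 0 : Section I M h) U where
  vec := (Bundle.contMDiff_zeroSection ℝ (fun y : M => TangentSpace I y)).contMDiffOn
  fst := contMDiffOn_const
  form := (Bundle.contMDiff_zeroSection ℝ (F := E →L[ℝ] ℝ)
    (fun y : M => TangentSpace I y →L[ℝ] Bundle.Trivial M ℝ y)).contMDiffOn
  snd := contMDiffOn_const

theorem SmoothOn.add {s t : Section I M h} (hs : SmoothOn s U) (ht : SmoothOn t U) :
    SmoothOn (fun x => s x + t x) U where
  vec := hs.vec.add_section ht.vec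
  fst := hs.fst.add ht.fst
  form := ContMDiffOn.add_section (F := E →L[ℝ] ℝ)
    (V := fun y : M => TangentSpace I y →L[ℝ] Bundle.Trivial M ℝ y) hs.form ht.form
  snd := hs.snd.add ht.snd

theorem SmoothOn.sub {s t : Section I M h} (hs : SmoothOn s U) (ht : SmoothOn t U) :
    SmoothOn (fun x => s x - t x) U where
  vec := hs.vec.sub_section ht.vec
  fst := hs.fst.sub ht.fst
  form := ContMDiffOn.sub_section (F := E →L[ℝ] ℝ)
    (V := fun y : M => TangentSpace I y →L[ℝ] Bundle.Trivial M ℝ y) hs.form ht.form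
  snd := hs.snd.sub ht.snd

theorem SmoothOn.smul {s : Section I M h} {f : M → ℝ} (hs : SmoothOn s U)
    (hf : ContMDiffOn I 𝓘(ℝ, ℝ) ∞ f U) : SmoothOn (fun x => f x • s x) U where
  vec := hf.smul_section hs.vec
  fst := hf.smul hs.fst
  form := ContMDiffOn.smul_section (F := E →L[ℝ] ℝ)
    (V := fun y : M => TangentSpace I y →L[ℝ] Bundle.Trivial M ℝ y) hf hs.form
  snd := hf.smul hs.snd

theorem SmoothOn.sum {ι : Type*} (t : Finset ι) {s : ι → Section I M h}
    (hs : ∀ i, SmoothOn (s i) U) : SmoothOn (fun x => ∑ i ∈ t, s i x) U := by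
  classical
  induction t using Finset.induction_on with
  | empty => simpa using SmoothOn.zero
  | insert a t ha ih => simpa only [Finset.sum_insert ha] using (hs a).add ih

variable {V : Fin k → ∀ x : M, TangentSpace I x}

theorem contMDiffOn_sum_smul
    (hV : ∀ p, ContMDiffOn I I.tangent ∞ (fun x => (⟨x, V p x⟩ : TangentBundle I M)) U)
    {w : M → Fin k → ℝ} (hw : ContMDiffOn I 𝓘(ℝ, Fin k → ℝ) ∞ w U) :
    ContMDiffOn I I.tangent ∞ (fun x => (⟨x, ∑ p, w x p • V p x⟩ : TangentBundle I M)) U :=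
  ContMDiffOn.sum_section fun p _ => (contMDiffOn_pi_space.1 hw p).smul_section (hV p)

theorem SmoothOn.liftFibre {s : Section I M h} (hs : SmoothOn s U)
    (hV : ∀ p, ContMDiffOn I I.tangent ∞ (fun x => (⟨x, V p x⟩ : TangentBundle I M)) U)
    {w : M → Fin k → ℝ} (hw : ContMDiffOn I 𝓘(ℝ, Fin k → ℝ) ∞ w U) :
    SmoothOn (fun x => liftFibre V (s x) (w x)) U where
  vec := hs.vec.sub_section (contMDiffOn_sum_smul hV hw)
  fst := contMDiffOn_append hs.fst
    (contMDiffOn_pi_space.2 fun p => pairing_contMDiffOn hs.form (hV p))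
  form := hs.form
  snd := contMDiffOn_append hs.snd hw

theorem SmoothOn.lowerFibre {s : Section I M (h + k)} (hs : SmoothOn s U)
    (hV : ∀ p, ContMDiffOn I I.tangent ∞ (fun x => (⟨x, V p x⟩ : TangentBundle I M)) U) :
    SmoothOn (fun x => lowerFibre V (s x)) U where
  vec := hs.vec.add_section (contMDiffOn_sum_smul hV
    (contMDiffOn_pi_space.2 fun p => contMDiffOn_pi_space.1 hs.snd (Fin.natAdd h p)))
  fst := contMDiffOn_pi_space.2 fun a => contMDiffOn_pi_space.1 hs.fst (Fin.castAdd k a)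
  form := hs.form
  snd := contMDiffOn_pi_space.2 fun a => contMDiffOn_pi_space.1 hs.snd (Fin.castAdd k a)

theorem isSubbundle_prolong {L : Family I M h} (hL : IsSubbundle L)
    (hV : ∀ p, ContMDiff I I.tangent ∞ (fun x => (⟨x, V p x⟩ : TangentBundle I M))) :
    IsSubbundle (prolong L V) := by
  intro x₀
  obtain ⟨U, hU, hx₀, r, s, hs, hb⟩ := hL x₀
  -- The frame before lifting: `(sᵢ, 0)` and `(0, e_p)`, a basis of `L x × ℝ^k`.
  let σ : Fin r ⊕ Fin k → ∀ x : M, Fibre I h x × (Fin k → ℝ) :=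
    Sum.elim (fun i x => (s i x, 0)) (fun p _ => (0, Pi.single p 1))
  refine ⟨U, hU, hx₀, r + k,
    fun i x => liftLinear V h x (σ (finSumFinEquiv.symm i) x), ?_, ?_⟩
  · intro i
    have key : ∀ j, SmoothOn (fun x => liftLinear V h x (σ j x)) U := by
      rintro (j | p)
      · exact (hs j).liftFibre (w := fun _ => 0) (fun p => (hV p).contMDiffOn) contMDiffOn_const
      · exact SmoothOn.zero.liftFibre (w := fun _ => Pi.single p 1)
          (fun p => (hV p).contMDiffOn) contMDiffOn_const
    exact key _
  · intro x hx
    obtain ⟨hli, hspan⟩ := hb x hx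
    have hσ : (fun i => σ i x) =
        Sum.elim (LinearMap.inl ℝ (Fibre I h x) (Fin k → ℝ) ∘ fun i => s i x)
        (LinearMap.inr ℝ (Fibre I h x) (Fin k → ℝ) ∘ fun p => Pi.basisFun ℝ (Fin k) p) := by
      funext i
      rcases i with i | i
      · rfl
      · simp [σ]
    constructor
    · refine LinearIndependent.map' (v := fun i => σ (finSumFinEquiv.symm i) x) ?_
        (liftLinear V h x) (LinearMap.ker_eq_bot.2 (liftLinear_injective V))
      refine (linearIndependent_equiv' (f := fun i => σ i x) finSumFinEquiv.symm rfl).2 ?_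
      rw [hσ]
      exact linearIndependent_inl_union_inr' hli (Pi.basisFun ℝ (Fin k)).linearIndependent
    · have hr : Set.range (fun i => liftLinear V h x (σ (finSumFinEquiv.symm i) x)) =
          liftLinear V h x '' Set.range (fun i => σ i x) := by
        rw [← Set.range_comp]
        exact finSumFinEquiv.symm.surjective.range_comp (fun i => liftLinear V h x (σ i x))
      rw [hr, ← Submodule.map_span, prolong_eq_map, hσ, Set.Sum.elim_range, Set.range_comp,
        Set.range_comp, LinearMap.span_inl_union_inr, hspan, (Pi.basisFun ℝ (Fin k)).span_eq]

theorem isAlmostDirac_prolong {L : Family I M h} (hL : IsAlmostDirac I L)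
    (hV : ∀ p, ContMDiff I I.tangent ∞ (fun x => (⟨x, V p x⟩ : TangentBundle I M))) :
    IsAlmostDirac I (prolong L V) where
  subbundle := isSubbundle_prolong hL.subbundle hV
  maximal_isotropic x := maximal_isIsotropic_prolong V (hL.maximal_isotropic x)

end Smooth

end

/-! ### Twist terms and the tangent part of the lifted bracket -/

section

variable {E : Type*} [NormedAddCommGroup E] [NormedSpace ℝ E]
  {H : Type*} [TopologicalSpace H] {I : ModelWithCorners ℝ E H}
  {M : Type*} [TopologicalSpace M] [ChartedSpace H M]

section Contraction

variable {x : M} {k : ℕ}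

theorem contract₂_apply (θ : TangentSpace I x [⋀^Fin 2]→L[ℝ] ℝ) (X Y : TangentSpace I x) :
    contract₂ θ X Y = θ ![X, Y] := by
  have h : Function.update ![X, 0] 1 Y = ![X, Y] := by
    ext i; fin_cases i <;> simp
  exact congrArg θ h

theorem contract₃_apply (θ : TangentSpace I x [⋀^Fin 3]→L[ℝ] ℝ) (X Y Z : TangentSpace I x) :
    contract₃ θ X Y Z = θ ![X, Y, Z] := by
  have h : Function.update ![X, Y, 0] 2 Z = ![X, Y, Z] := by
    ext i; fin_cases i <;> rfl
  exact congrArg θ h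

theorem alternating₂_swap (θ : TangentSpace I x [⋀^Fin 2]→L[ℝ] ℝ) (X Y : TangentSpace I x) :
    θ ![Y, X] = -θ ![X, Y] := by
  have h : ![X, Y] ∘ Equiv.swap (0 : Fin 2) 1 = ![Y, X] := by
    ext i; fin_cases i <;> rfl
  rw [← h]
  exact θ.toAlternatingMap.map_swap _ (by decide)

theorem alternating₃_swap_left (θ : TangentSpace I x [⋀^Fin 3]→L[ℝ] ℝ) (X Y Z : TangentSpace I x) :
    θ ![Y, X, Z] = -θ ![X, Y, Z] := by
  have h : ![X, Y, Z] ∘ Equiv.swap (0 : Fin 3) 1 = ![Y, X, Z] := by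
    ext i; fin_cases i <;> rfl
  rw [← h]
  exact θ.toAlternatingMap.map_swap _ (by decide)

theorem alternating₃_swap_right (θ : TangentSpace I x [⋀^Fin 3]→L[ℝ] ℝ)
    (X Y Z : TangentSpace I x) : θ ![X, Z, Y] = -θ ![X, Y, Z] := by
  have h : ![X, Y, Z] ∘ Equiv.swap (1 : Fin 3) 2 = ![X, Z, Y] := by
    ext i; fin_cases i <;> rfl
  rw [← h]
  exact θ.toAlternatingMap.map_swap _ (by decide)

theorem alternating₂_sub_sum {θ : TangentSpace I x [⋀^Fin 2]→L[ℝ] ℝ} {V : Fin k → TangentSpace I x}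
    (hθ : ∀ p Y, θ ![V p, Y] = 0) (w : Fin k → ℝ) (X Y : TangentSpace I x) :
    θ ![X - ∑ p, w p • V p, Y] = θ ![X, Y] := by
  have h : ∀ Z, θ ![Z, Y] = θ.toMultilinearMap.toLinearMap ![0, Y] 0 Z := fun Z => by
    refine congrArg θ ?_
    ext i; fin_cases i <;> simp
  rw [h, map_sub, map_sum, ← h, Finset.sum_eq_zero, sub_zero]
  intro p _
  rw [map_smul, ← h, hθ, smul_zero]

theorem alternating₂_sub_sum_sub_sum {θ : TangentSpace I x [⋀^Fin 2]→L[ℝ] ℝ}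
    {V : Fin k → TangentSpace I x} (hθ : ∀ p Y, θ ![V p, Y] = 0) (w w' : Fin k → ℝ)
    (X Y : TangentSpace I x) :
    θ ![X - ∑ p, w p • V p, Y - ∑ p, w' p • V p] = θ ![X, Y] := by
  rw [alternating₂_sub_sum hθ, alternating₂_swap, alternating₂_sub_sum hθ, ← alternating₂_swap]

theorem contract₂_sub_sum {θ : TangentSpace I x [⋀^Fin 2]→L[ℝ] ℝ} {V : Fin k → TangentSpace I x}
    (hθ : ∀ p Y, θ ![V p, Y] = 0) (w : Fin k → ℝ) (X : TangentSpace I x) :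
    contract₂ θ (X - ∑ p, w p • V p) = contract₂ θ X := by
  ext Y
  rw [contract₂_apply, contract₂_apply, alternating₂_sub_sum hθ]

theorem alternating₃_sub_sum {θ : TangentSpace I x [⋀^Fin 3]→L[ℝ] ℝ} {V : Fin k → TangentSpace I x}
    (hθ : ∀ p Y Z, θ ![V p, Y, Z] = 0) (w : Fin k → ℝ) (X Y Z : TangentSpace I x) :
    θ ![X - ∑ p, w p • V p, Y, Z] = θ ![X, Y, Z] := by
  have h : ∀ W, θ ![W, Y, Z] = θ.toMultilinearMap.toLinearMap ![0, Y, Z] 0 W := fun W => by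
    refine congrArg θ ?_
    ext i; fin_cases i <;> simp
  rw [h, map_sub, map_sum, ← h, Finset.sum_eq_zero, sub_zero]
  intro p _
  rw [map_smul, ← h, hθ, smul_zero]

theorem contract₃_sub_sum_sub_sum {θ : TangentSpace I x [⋀^Fin 3]→L[ℝ] ℝ}
    {V : Fin k → TangentSpace I x} (hθ : ∀ p Y Z, θ ![V p, Y, Z] = 0) (w w' : Fin k → ℝ)
    (X Y : TangentSpace I x) :
    contract₃ θ (X - ∑ p, w p • V p) (Y - ∑ p, w' p • V p) = contract₃ θ X Y := by
  ext Z
  rw [contract₃_apply, contract₃_apply, alternating₃_sub_sum hθ, alternating₃_swap_left,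
    alternating₃_sub_sum hθ, ← alternating₃_swap_left]

end Contraction

/-- Differentiability is proved jointly because the induction step for the derivative needs it for
the partial sum. -/
theorem mvfderiv_sub_sum {ι : Type*} (t : Finset ι) {f : M → ℝ} {w g : ι → M → ℝ} {x : M}
    (hf : MDifferentiableAt I 𝓘(ℝ, ℝ) f x) (hw : ∀ p, MDifferentiableAt I 𝓘(ℝ, ℝ) (w p) x)
    (hg : ∀ p, MDifferentiableAt I 𝓘(ℝ, ℝ) (g p) x) :
    MDifferentiableAt I 𝓘(ℝ, ℝ) (fun y => f y - ∑ p ∈ t, w p y * g p y) x ∧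
    mvfderiv I (fun y => f y - ∑ p ∈ t, w p y * g p y) x =
      mvfderiv I f x - ∑ p ∈ t, (w p x • mvfderiv I (g p) x + g p x • mvfderiv I (w p) x) := by
  classical
  induction t using Finset.induction_on with
  | empty => simpa using hf
  | insert a t ha ih =>
    have e : (fun y => f y - ∑ p ∈ insert a t, w p y * g p y) =
        fun y => (f y - ∑ p ∈ t, w p y * g p y) - (w a * g a) y := by
      ext y
      rw [Finset.sum_insert ha, Pi.mul_apply]
      ring
    rw [e]
    refine ⟨ih.1.sub ((hw a).mul (hg a)), ?_⟩
    rw [mvfderiv_fun_sub ih.1 ((hw a).mul (hg a)), ih.2, mvfderiv_mul (hw a) (hg a),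
      Finset.sum_insert ha]
    abel

variable [IsManifold I ∞ M]

theorem mlieBracket_sub_sum_sub_sum [CompleteSpace E] {k : ℕ} {X₁ X₂ : ∀ x : M, TangentSpace I x}
    {V : Fin k → ∀ x : M, TangentSpace I x} {w₁ w₂ : Fin k → M → ℝ} {x : M}
    (hX₁ : MDifferentiableAt I I.tangent (fun y => (⟨y, X₁ y⟩ : TangentBundle I M)) x)
    (hX₂ : MDifferentiableAt I I.tangent (fun y => (⟨y, X₂ y⟩ : TangentBundle I M)) x)
    (hV : ∀ p, MDifferentiableAt I I.tangent (fun y => (⟨y, V p y⟩ : TangentBundle I M)) x)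
    (hw₁ : ∀ p, MDifferentiableAt I 𝓘(ℝ, ℝ) (w₁ p) x)
    (hw₂ : ∀ p, MDifferentiableAt I 𝓘(ℝ, ℝ) (w₂ p) x)
    (hcomm : ∀ p q, mlieBracket I (V p) (V q) x = 0) :
    mlieBracket I (fun y => X₁ y - ∑ p, w₁ p y • V p y) (fun y => X₂ y - ∑ p, w₂ p y • V p y) x =
      mlieBracket I X₁ X₂ x +
        ∑ p, (w₂ p x • mlieBracket I (V p) X₁ x - w₁ p x • mlieBracket I (V p) X₂ x) -
        ∑ p, (mvfderiv I (w₂ p) x (X₁ x - ∑ q, w₁ q x • V q x) -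
          mvfderiv I (w₁ p) x (X₂ x - ∑ q, w₂ q x • V q x)) • V p x := by
  have h : ∀ p, mlieBracket I X₁ (V p) x = -mlieBracket I (V p) X₁ x :=
    fun p => mlieBracket_swap_apply
  -- Exchanging the sums collects the coefficient of each `V p`, giving derivatives along the full
  -- lifted field.
  have hs : ∑ p, w₁ p x • ∑ q, mvfderiv I (w₂ q) x (V p x) • V q x =
      ∑ p, (∑ q, w₁ q x * mvfderiv I (w₂ p) x (V q x)) • V p x := by
    simp only [Finset.smul_sum, Finset.sum_smul, smul_smul]
    exact Finset.sum_comm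
  rw [mlieBracket_sub_sum_left _ hX₁ hV hw₁, mlieBracket_sub_sum_right _ hX₂ hV hw₂]
  simp only [mlieBracket_sub_sum_right _ hX₂ hV hw₂, hcomm, h, smul_zero, zero_add, smul_neg,
    smul_sub, sub_smul, map_sub, map_sum, map_smul, Finset.sum_add_distrib,
    Finset.sum_sub_distrib, Finset.sum_neg_distrib, hs, smul_eq_mul]
  abel

/-- The section of `L` underlying the bracket of the lifts of `(s₁, w₁)` and `(s₂, w₂)`. -/
def liftBracket {h k : ℕ} (Φ : Form I M 3) (Ψ : Fin h → Form I M 2)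
    (V : Fin k → ∀ x : M, TangentSpace I x) (s₁ s₂ : Section I M h) (w₁ w₂ : M → Fin k → ℝ) :
    Section I M h := fun x =>
  bracket Φ Ψ s₁ s₂ x +
    ∑ p, (w₂ x p • lieDerivSection (V p) s₁ x - w₁ x p • lieDerivSection (V p) s₂ x)

/-- The `ℝ^k`-component of the bracket of the lifts of `(s₁, w₁)` and `(s₂, w₂)`. -/
def liftCoeff {h k : ℕ} (V : Fin k → ∀ x : M, TangentSpace I x) (s₁ s₂ : Section I M h)
    (w₁ w₂ : M → Fin k → ℝ) (x : M) : Fin k → ℝ := fun p =>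
  mvfderiv I (fun y => w₂ y p) x (liftFibre V (s₁ x) (w₁ x)).1.1 -
    mvfderiv I (fun y => w₁ y p) x (liftFibre V (s₂ x) (w₂ x)).1.1

end

/-! ### The bracket of two lifts -/

section

variable {E : Type*} [NormedAddCommGroup E] [NormedSpace ℝ E]
  {H : Type*} [TopologicalSpace H] {I : ModelWithCorners ℝ E H}
  {M : Type*} [TopologicalSpace M] [ChartedSpace H M] [IsManifold I ∞ M]

section Differentiability

variable {h : ℕ} {s : Section I M h}

theorem SmoothOn.mdifferentiableAt_vec (hs : SmoothOn s Set.univ) (x : M) :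
    MDifferentiableAt I I.tangent (fun y => (⟨y, (s y).1.1⟩ : TangentBundle I M)) x :=
  (hs.vec.contMDiffAt Filter.univ_mem).mdifferentiableAt (by simp)

theorem SmoothOn.mdifferentiableAt_form (hs : SmoothOn s Set.univ) (x : M) :
    MDifferentiableAt I (I.prod 𝓘(ℝ, E →L[ℝ] ℝ))
    (fun x => Bundle.TotalSpace.mk' (E →L[ℝ] ℝ) (E := fun y : M => (TangentSpace I y →L[ℝ] ℝ))
      x (s x).2.1) x :=
  (hs.form.contMDiffAt Filter.univ_mem).mdifferentiableAt (by simp)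

end Differentiability

/-- By Cartan's formula the two sides differ by `G(L_V s₁, s₂) - G(L_V s₂, s₁)`: the halves in the
bracket match the half in the metric. The twist terms vanish on `V`. -/
theorem bracket_form_apply [CompleteSpace E] {h : ℕ} {Φ : Form I M 3} {Ψ : Fin h → Form I M 2}
    {s₁ s₂ : Section I M h} (hs₁ : SmoothOn s₁ Set.univ) (hs₂ : SmoothOn s₂ Set.univ)
    {V : ∀ x : M, TangentSpace I x} {x : M}
    (hV : MDifferentiableAt I I.tangent (fun y => (⟨y, V y⟩ : TangentBundle I M)) x)
    (h₁₂ : metric (lieDerivSection V s₁ x) (s₂ x) = 0)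
    (h₂₁ : metric (lieDerivSection V s₂ x) (s₁ x) = 0)
    (hΦ : ∀ Y Z, Φ x ![V x, Y, Z] = 0) (hΨ : ∀ a Y, Ψ a x ![V x, Y] = 0) :
    (bracket Φ Ψ s₁ s₂ x).2.1 (V x) =
      mvfderiv I (fun y => (s₂ y).2.1 (V y)) x (s₁ x).1.1 -
        mvfderiv I (fun y => (s₁ y).2.1 (V y)) x (s₂ x).1.1 := by
  have hX₁ := hs₁.mdifferentiableAt_vec x
  have hX₂ := hs₂.mdifferentiableAt_vec x
  have hα₁ := hs₁.mdifferentiableAt_form x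
  have hα₂ := hs₂.mdifferentiableAt_form x
  have e₃ : contract₃ (Φ x) (s₁ x).1.1 (s₂ x).1.1 (V x) = 0 := by
    rw [contract₃_apply, alternating₃_swap_right, alternating₃_swap_left, hΦ]
    simp
  have e₂ : ∀ a Y, contract₂ (Ψ a x) Y (V x) = 0 := fun a Y => by
    rw [contract₂_apply, alternating₂_swap, hΨ, neg_zero]
  have b₁ : mlieBracket I (fun y => (s₁ y).1.1) V x = -mlieBracket I V (fun y => (s₁ y).1.1) x :=
    mlieBracket_swap_apply
  have b₂ : mlieBracket I (fun y => (s₂ y).1.1) V x = -mlieBracket I V (fun y => (s₂ y).1.1) x :=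
    mlieBracket_swap_apply
  have l₁ := lieDerivForm_apply (X := V) hX₂ hα₁
  have l₂ := lieDerivForm_apply (X := V) hX₁ hα₂
  simp only [metric, lieDerivSection, l₁] at h₁₂
  simp only [metric, lieDerivSection, l₂] at h₂₁
  simp only [bracket, add_apply, sub_apply, smul_apply, sum_apply, e₃, e₂,
    lieDerivForm_apply hV hα₂, lieDerivForm_apply hV hα₁, b₁, b₂, map_neg,
    mvfderiv_fun_sub (pairing_mdifferentiableAt hα₁ hX₂) (pairing_mdifferentiableAt hα₂ hX₁),
    mul_zero, Finset.sum_const_zero, dotD, smul_eq_mul]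
  simp only [dotProduct, dirDeriv] at h₁₂ h₂₁
  have cm : ∀ f g : Fin h → ℝ, ∑ a, f a * g a = ∑ a, g a * f a := fun f g =>
    Finset.sum_congr rfl fun _ _ => mul_comm _ _
  rw [cm (fun a => mvfderiv I (fun y => (s₁ y).1.2 a) x (V x))] at h₁₂
  rw [cm (fun a => mvfderiv I (fun y => (s₂ y).1.2 a) x (V x))] at h₂₁
  linarith

/-- The decomposition is again a lift, with underlying section a combination of `[s₁, s₂]` and Lie
derivatives along the `V p`; this is what closes the prolongation under the bracket. -/
theorem bracket_liftFibre [CompleteSpace E] {h k : ℕ} {Φ : Form I M 3} {Ψ : Fin h → Form I M 2}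
    {s₁ s₂ : Section I M h} (hs₁ : SmoothOn s₁ Set.univ) (hs₂ : SmoothOn s₂ Set.univ)
    {V : Fin k → ∀ x : M, TangentSpace I x} {w₁ w₂ : M → Fin k → ℝ} {x : M}
    (hV : ∀ p, MDifferentiableAt I I.tangent (fun y => (⟨y, V p y⟩ : TangentBundle I M)) x)
    (hw₁ : ∀ p, MDifferentiableAt I 𝓘(ℝ, ℝ) (fun y => w₁ y p) x)
    (hw₂ : ∀ p, MDifferentiableAt I 𝓘(ℝ, ℝ) (fun y => w₂ y p) x)
    (hcomm : ∀ p q, mlieBracket I (V p) (V q) x = 0)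
    (h₁₂ : ∀ p, metric (lieDerivSection (V p) s₁ x) (s₂ x) = 0)
    (h₂₁ : ∀ p, metric (lieDerivSection (V p) s₂ x) (s₁ x) = 0)
    (hΦ : ∀ p Y Z, Φ x ![V p x, Y, Z] = 0) (hΨ : ∀ p a Y, Ψ a x ![V p x, Y] = 0) :
    bracket Φ (extendZero k Ψ) (fun y => liftFibre V (s₁ y) (w₁ y))
        (fun y => liftFibre V (s₂ y) (w₂ y)) x =
      liftFibre V (liftBracket Φ Ψ V s₁ s₂ w₁ w₂ x) (liftCoeff V s₁ s₂ w₁ w₂ x) := by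
  have hX₁ := hs₁.mdifferentiableAt_vec x
  have hX₂ := hs₂.mdifferentiableAt_vec x
  have hα₁ := hs₁.mdifferentiableAt_form x
  have hα₂ := hs₂.mdifferentiableAt_form x
  apply fibre_ext
  · refine (mlieBracket_sub_sum_sub_sum hX₁ hX₂ hV hw₁ hw₂ hcomm).trans ?_
    simp [liftFibre, liftBracket, liftCoeff, bracket, lieDerivSection, Prod.fst_sum]
  · funext i
    refine Fin.addCases (fun a => ?_) (fun p => ?_) i
    · simp [liftFibre, liftBracket, bracket, lieDerivSection, Prod.fst_sum,
        Prod.snd_sum, dirDeriv, Finset.sum_sub_distrib]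
      abel
    · have hb := bracket_form_apply (Φ := Φ) (Ψ := Ψ) hs₁ hs₂ (hV p) (h₁₂ p) (h₂₁ p) (hΦ p) (hΨ p)
      -- Since `V q` and `V p` commute, `(L_{V_q} α)(V_p) = V_q(α(V_p))`, which supplies the
      -- derivatives along `w·V`.
      have l₁ : ∀ q, lieDerivForm I (V q) (fun y => (s₁ y).2.1) x (V p x) =
          mvfderiv I (fun y => (s₁ y).2.1 (V p y)) x (V q x) := fun q => by
        rw [lieDerivForm_apply (hV p) hα₁, hcomm]; simp
      have l₂ : ∀ q, lieDerivForm I (V q) (fun y => (s₂ y).2.1) x (V p x) =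
          mvfderiv I (fun y => (s₂ y).2.1 (V p y)) x (V q x) := fun q => by
        rw [lieDerivForm_apply (hV p) hα₂, hcomm]; simp
      have hr : (liftBracket Φ Ψ V s₁ s₂ w₁ w₂ x).2.1 (V p x) =
          (bracket Φ Ψ s₁ s₂ x).2.1 (V p x) +
            ∑ q, (w₂ x q * lieDerivForm I (V q) (fun y => (s₁ y).2.1) x (V p x) -
              w₁ x q * lieDerivForm I (V q) (fun y => (s₂ y).2.1) x (V p x)) := by
        simp [liftBracket, lieDerivSection, Prod.snd_sum, Prod.fst_sum, sum_apply]
      have hl : (liftFibre V (liftBracket Φ Ψ V s₁ s₂ w₁ w₂ x) (liftCoeff V s₁ s₂ w₁ w₂ x)).1.2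
          (Fin.natAdd h p) = (liftBracket Φ Ψ V s₁ s₂ w₁ w₂ x).2.1 (V p x) := by
        simp [liftFibre]
      rw [hl, hr, hb]
      simp only [l₁, l₂]
      simp [bracket, liftFibre, dirDeriv]
      ring
  · have d₁ : mvfderiv I (fun y => (s₁ y).2.1 ((s₂ y).1.1 - ∑ p, w₂ y p • V p y)) x = _ :=
      (congrArg (fun f => mvfderiv I f x) (by ext y; simp)).trans
        (mvfderiv_sub_sum Finset.univ (pairing_mdifferentiableAt hα₁ hX₂) hw₂
          (fun p => pairing_mdifferentiableAt hα₁ (hV p))).2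
    have d₂ : mvfderiv I (fun y => (s₂ y).2.1 ((s₁ y).1.1 - ∑ p, w₁ y p • V p y)) x = _ :=
      (congrArg (fun f => mvfderiv I f x) (by ext y; simp)).trans
        (mvfderiv_sub_sum Finset.univ (pairing_mdifferentiableAt hα₂ hX₁) hw₁
          (fun p => pairing_mdifferentiableAt hα₂ (hV p))).2
    have d : mvfderiv I (fun y => (s₁ y).2.1 ((s₂ y).1.1 - ∑ p, w₂ y p • V p y) -
        (s₂ y).2.1 ((s₁ y).1.1 - ∑ p, w₁ y p • V p y)) x = _ :=
      (mvfderiv_fun_sub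
        (pairing_mdifferentiableAt hα₁ (mdifferentiableAt_sub_sum Finset.univ hX₂ hV hw₂))
        (pairing_mdifferentiableAt hα₂ (mdifferentiableAt_sub_sum Finset.univ hX₁ hV hw₁))).trans
      (congrArg₂ (· - ·) d₁ d₂)
    have hc : contract₃ (Φ x) ((s₁ x).1.1 - ∑ p, w₁ x p • V p x)
        ((s₂ x).1.1 - ∑ p, w₂ x p • V p x) = contract₃ (Φ x) (s₁ x).1.1 (s₂ x).1.1 :=
      contract₃_sub_sum_sub_sum hΦ _ _ _ _
    have hz : ∀ Y : TangentSpace I x, contract₂ (0 : TangentSpace I x [⋀^Fin 2]→L[ℝ] ℝ) Y = 0 := by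
      intro Y; ext Z; rw [contract₂_apply]; rfl
    -- The appended zero forms kill the block `b`, and `i(V_p)Ψᵃ = 0` removes `w·V`.
    have hc₂ : ∀ (u : Fin h → ℝ) (b : Fin k → ℝ) (w : Fin k → ℝ) (Y : TangentSpace I x),
        ∑ a, Fin.append u b a • contract₂ (extendZero k Ψ a x) (Y - ∑ p, w p • V p x) =
          ∑ a, u a • contract₂ (Ψ a x) Y := by
      intro u b w Y
      simp only [Fin.sum_univ_add, Fin.append_left, Fin.append_right, extendZero, hz, smul_zero,
        Finset.sum_const_zero, add_zero]
      exact Finset.sum_congr rfl fun a _ => by rw [contract₂_sub_sum (fun p => hΨ p a)]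
    simp only [bracket, liftFibre, hc, hc₂]
    simp only [d, bracket, liftBracket, lieDerivSection,
      lieDerivForm_sub_sum Finset.univ hX₁ hV hw₁, lieDerivForm_sub_sum Finset.univ hX₂ hV hw₂,
      dotD, Fin.sum_univ_add, Fin.append_left, Fin.append_right, Prod.snd_add, Prod.fst_add,
      Prod.snd_sum, Prod.fst_sum, Prod.smul_fst, Prod.smul_snd, Finset.sum_add_distrib,
      Prod.fst_sub, Prod.snd_sub, Finset.sum_sub_distrib,
      mvfderiv_fun_sub (pairing_mdifferentiableAt hα₁ hX₂) (pairing_mdifferentiableAt hα₂ hX₁)]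
    -- The terms `α₂(V) dw₁` and `α₁(V) dw₂` from the Lie derivatives cancel against two halves, one
    -- from the exact term and one from the `dotD` terms of the new components. The terms `w
    -- d(α(V))` cancel between those two sources.
    module
  · funext i
    refine Fin.addCases (fun a => ?_) (fun p => ?_) i
    · have e := alternating₂_sub_sum_sub_sum (fun p => hΨ p a) (w₁ x) (w₂ x) (s₁ x).1.1 (s₂ x).1.1
      simp [liftFibre, liftBracket, bracket, lieDerivSection, Prod.fst_sum,
        Prod.snd_sum, dirDeriv, Finset.sum_sub_distrib, extendZero] at e ⊢
      linarith
    · simp [bracket, liftFibre, liftCoeff, dirDeriv, extendZero]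

end

/-! ### Sections of the prolongation and integrability -/

section

variable {E : Type*} [NormedAddCommGroup E] [NormedSpace ℝ E]
  {H : Type*} [TopologicalSpace H] {I : ModelWithCorners ℝ E H}
  {M : Type*} [TopologicalSpace M] [ChartedSpace H M]

theorem isSmoothClosed_zero {n : ℕ} : IsSmoothClosed (fun _ => 0 : Form I M n) := by
  have h : ∀ x₀ : M, chartForm (fun _ => 0 : Form I M n) x₀ = fun _ => 0 := by
    intro x₀
    funext y
    ext v
    rfl
  refine ⟨fun x₀ => ?_, fun x₀ y _ => ?_⟩
  · rw [h]; exact contDiffOn_const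
  · rw [h]
    simp only [extDerivWithin, fderivWithin_fun_const, Pi.zero_apply]
    exact map_zero (ContinuousAlternatingMap.alternatizeUncurryFinCLM ℝ E ℝ)

theorem IsTwist.extendZero {h k : ℕ} {Φ : Form I M 3} {Ψ : Fin h → Form I M 2}
    (hT : IsTwist Φ Ψ) : IsTwist Φ (extendZero k Ψ) where
  form₃ := hT.form₃
  form₂ i := by
    refine Fin.addCases (fun a => ?_) (fun p => ?_) i
    · simpa [StableDirac.extendZero] using hT.form₂ a
    · simpa [StableDirac.extendZero] using isSmoothClosed_zero

theorem extendZero_zero (h k : ℕ) :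
    extendZero k (fun _ _ => 0 : Fin h → Form I M 2) = fun _ _ => 0 := by
  funext i
  refine Fin.addCases (fun a => ?_) (fun p => ?_) i <;> simp [extendZero]

variable [IsManifold I ∞ M] {h k : ℕ} {L : Family I M h}

theorem IsSectionOf.add {s t : Section I M h} (hs : IsSectionOf L s) (ht : IsSectionOf L t) :
    IsSectionOf L (fun x => s x + t x) :=
  ⟨hs.1.add ht.1, fun x => (L x).add_mem (hs.2 x) (ht.2 x)⟩

theorem IsSectionOf.smul {s : Section I M h} (hs : IsSectionOf L s) {f : M → ℝ}
    (hf : ContMDiff I 𝓘(ℝ, ℝ) ∞ f) : IsSectionOf L (fun x => f x • s x) :=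
  ⟨hs.1.smul hf.contMDiffOn, fun x => (L x).smul_mem _ (hs.2 x)⟩

theorem IsSectionOf.sub {s t : Section I M h} (hs : IsSectionOf L s) (ht : IsSectionOf L t) :
    IsSectionOf L (fun x => s x - t x) :=
  ⟨hs.1.sub ht.1, fun x => (L x).sub_mem (hs.2 x) (ht.2 x)⟩

theorem IsSectionOf.sum {ι : Type*} (t : Finset ι) {s : ι → Section I M h}
    (hs : ∀ i, IsSectionOf L (s i)) : IsSectionOf L (fun x => ∑ i ∈ t, s i x) :=
  ⟨SmoothOn.sum t fun i => (hs i).1, fun x => (L x).sum_mem fun i _ => (hs i).2 x⟩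

variable {V : Fin k → ∀ x : M, TangentSpace I x}

/-- The coefficients `w` are the last `k` components of `s` and `t` is `lowerFibre V` of it, so both
are smooth. -/
theorem IsSectionOf.exists_liftFibre {s : Section I M (h + k)}
    (hs : IsSectionOf (prolong L V) s)
    (hV : ∀ p, ContMDiff I I.tangent ∞ (fun x => (⟨x, V p x⟩ : TangentBundle I M))) :
    ∃ (t : Section I M h) (w : M → Fin k → ℝ), IsSectionOf L t ∧
      (∀ p, ContMDiff I 𝓘(ℝ, ℝ) ∞ fun x => w x p) ∧ s = fun x => liftFibre V (t x) (w x) := by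
  have key : ∀ x, lowerFibre V (s x) ∈ L x ∧
      s x = liftFibre V (lowerFibre V (s x)) (fun p => (s x).2.2 (Fin.natAdd h p)) := by
    intro x
    obtain ⟨η, hη, w, e⟩ := (mem_prolong V).1 (hs.2 x)
    rw [e, lowerFibre_liftFibre]
    refine ⟨hη, congrArg _ ?_⟩
    funext p
    simp [liftFibre]
  exact ⟨fun x => lowerFibre V (s x), fun x p => (s x).2.2 (Fin.natAdd h p),
    ⟨hs.1.lowerFibre fun p => (hV p).contMDiffOn, fun x => (key x).1⟩,
    fun p => contMDiffOn_univ.1 (contMDiffOn_pi_space.1 hs.1.snd (Fin.natAdd h p)),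
    funext fun x => (key x).2⟩

theorem IsSectionOf.liftFibre {t : Section I M h} (ht : IsSectionOf L t)
    (hV : ∀ p, ContMDiff I I.tangent ∞ (fun x => (⟨x, V p x⟩ : TangentBundle I M)))
    {w : M → Fin k → ℝ} (hw : ∀ p, ContMDiff I 𝓘(ℝ, ℝ) ∞ fun x => w x p) :
    IsSectionOf (prolong L V) (fun x => liftFibre V (t x) (w x)) :=
  ⟨ht.1.liftFibre (fun p => (hV p).contMDiffOn)
    (contMDiffOn_pi_space.2 fun p => (hw p).contMDiffOn),
    fun x => (mem_prolong V).2 ⟨t x, ht.2 x, w x, rfl⟩⟩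

theorem isSectionOf_bracket_prolong [CompleteSpace E] {Φ : Form I M 3} {Ψ : Fin h → Form I M 2}
    (hL : ∀ x, IsIsotropic (L x))
    (hint : ∀ s₁ s₂, IsSectionOf L s₁ → IsSectionOf L s₂ → IsSectionOf L (bracket Φ Ψ s₁ s₂))
    (hV : ∀ p, IsInfinitesimalAutomorphism (V p) L)
    (hcomm : ∀ p q, ∀ x : M, mlieBracket I (V p) (V q) x = 0)
    (hΦ : ∀ p, ∀ x : M, ∀ Y Z : TangentSpace I x, Φ x ![V p x, Y, Z] = 0)
    (hΨ : ∀ p a, ∀ x : M, ∀ Y : TangentSpace I x, Ψ a x ![V p x, Y] = 0)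
    {s₁ s₂ : Section I M (h + k)} (hs₁ : IsSectionOf (prolong L V) s₁)
    (hs₂ : IsSectionOf (prolong L V) s₂) :
    IsSectionOf (prolong L V) (bracket Φ (extendZero k Ψ) s₁ s₂) := by
  have hsm : ∀ p, ContMDiff I I.tangent ∞ (fun x => (⟨x, V p x⟩ : TangentBundle I M)) :=
    fun p => (hV p).smooth
  obtain ⟨t₁, w₁, ht₁, hw₁, rfl⟩ := hs₁.exists_liftFibre hsm
  obtain ⟨t₂, w₂, ht₂, hw₂, rfl⟩ := hs₂.exists_liftFibre hsm
  have e : bracket Φ (extendZero k Ψ) (fun y => liftFibre V (t₁ y) (w₁ y))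
      (fun y => liftFibre V (t₂ y) (w₂ y)) = fun x =>
      liftFibre V (liftBracket Φ Ψ V t₁ t₂ w₁ w₂ x) (liftCoeff V t₁ t₂ w₁ w₂ x) := by
    funext x
    exact bracket_liftFibre ht₁.1 ht₂.1 (fun p => (hsm p).mdifferentiable (by simp) x)
      (fun p => (hw₁ p).mdifferentiable (by simp) x) (fun p => (hw₂ p).mdifferentiable (by simp) x)
      (fun p q => hcomm p q x)
      -- Both `L_{V_p} t₁` and `t₂` take values in `L`, which is isotropic.
      (fun p => hL x _ (((hV p).lie_mem t₁ ht₁).2 x) _ (ht₂.2 x))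
      (fun p => hL x _ (((hV p).lie_mem t₂ ht₂).2 x) _ (ht₁.2 x))
      (fun p => hΦ p x) (fun p a => hΨ p a x)
  rw [e]
  refine IsSectionOf.liftFibre ?_ hsm fun p => ?_
  · exact (hint t₁ t₂ ht₁ ht₂).add (IsSectionOf.sum _ fun p =>
      (((hV p).lie_mem t₁ ht₁).smul (hw₂ p)).sub (((hV p).lie_mem t₂ ht₂).smul (hw₁ p)))
  · exact (mvfderiv_apply_contMDiff (hw₂ p) (contMDiffOn_univ.1 hs₁.1.vec)).sub
      (mvfderiv_apply_contMDiff (hw₁ p) (contMDiffOn_univ.1 hs₂.1.vec))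

end

end StableDirac

end

theorem theorem2p1 {E : Type*} [NormedAddCommGroup E] [NormedSpace ℝ E] [FiniteDimensional ℝ E]
    {H : Type*} [TopologicalSpace H] {I : ModelWithCorners ℝ E H} [I.Boundaryless]
    {M : Type*} [TopologicalSpace M] [ChartedSpace H M] [IsManifold I ∞ M]
    [T2Space M] [SigmaCompactSpace M]
    (h k : ℕ) (L : StableDirac.Family I M h) (V : Fin k → ∀ x : M, TangentSpace I x)
    (hV : ∀ p, StableDirac.IsInfinitesimalAutomorphism (V p) L)
    (hcomm : ∀ p q, ∀ x : M, VectorField.mlieBracket I (V p) (V q) x = 0) :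
    (StableDirac.IsUntwistedDirac L → StableDirac.IsUntwistedDirac (StableDirac.prolong L V)) ∧
    (∀ (Φ : StableDirac.Form I M 3) (Ψ : Fin h → StableDirac.Form I M 2),
      StableDirac.IsTwistedDirac Φ Ψ L →
      (∀ p, ∀ x : M, ∀ Y Z : TangentSpace I x, Φ x ![V p x, Y, Z] = 0) →
      (∀ p a, ∀ x : M, ∀ Y : TangentSpace I x, Ψ a x ![V p x, Y] = 0) →
      StableDirac.IsTwistedDirac Φ (StableDirac.extendZero k Ψ) (StableDirac.prolong L V)) := by
  have : CompleteSpace E := FiniteDimensional.complete ℝ E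
  have hsm : ∀ p, ContMDiff I I.tangent ∞ (fun x => (⟨x, V p x⟩ : TangentBundle I M)) :=
    fun p => (hV p).smooth
  refine ⟨fun hL => ⟨StableDirac.isAlmostDirac_prolong hL.almost hsm, fun s₁ s₂ hs₁ hs₂ => ?_⟩,
    fun Φ Ψ hL hΦ hΨ => ⟨hL.twist.extendZero, StableDirac.isAlmostDirac_prolong hL.almost hsm,
      fun s₁ s₂ hs₁ hs₂ => ?_⟩⟩
  -- The untwisted case is the twisted one with zero forms, for which the contraction conditions are
  -- trivial.
  · rw [← StableDirac.extendZero_zero]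
    exact StableDirac.isSectionOf_bracket_prolong (fun x => (hL.almost.maximal_isotropic x).prop)
      hL.integrable hV hcomm (fun _ _ _ _ => rfl) (fun _ _ _ _ => rfl) hs₁ hs₂
  · exact StableDirac.isSectionOf_bracket_prolong
      (fun x => (hL.almost.maximal_isotropic x).prop) hL.integrable hV hcomm hΦ hΨ hs₁ hs₂
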